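/- Let $n\ge 1$ and let $\Omega\subset\mathbb{R}^n$ be open. Let $X=\Omega$, or, if $\Omega$ has Lipschitz boundary (near each boundary point, in suitable orthonormal coordinates, $\Omega$ is the region above the graph of a Lipschitz function), let $X=\overline{\Omega}$. Let $u:X\to\mathbb{R}$ be Lipschitz, and for a function $v$ on $X$ put $Z_v=\{x\in X: v(x)=0\}$. We use the convention $\log 0=-\infty$. For an extended real valued function $f$ on $X$ and a set $Z\subset X$ closed in $X$, we write $f\in W^{1,n}_{loc}(X\setminus Z)$, with "local" understood relative to $X$, if $f$ is finite almost everywhere on $\Omega$ and every point of $X$ (including the points of $Z$) has an open neighbourhood $U$ in $\mathbb{R}^n$ such that $f\in W^{1,n}(U\cap(\Omega\setminus Z))$, i.e. $f$ and its weak gradient on $U\cap(\Omega\setminus Z)$ are in $L^n(U\cap(\Omega\setminus Z))$. Then: 1. For every $a\in X$, $\log|u-u(a)|\notin W^{1,n}_{loc}(X\setminus Z_{u-u(a)})$. 2. More precisely, disregarding the values of the logarithm on the zero set: if $a\in X$ and $u\not\equiv u(a)$ on $\Omega\cap V$ for every neighbourhood $V$ of $a$, then $\log|u-u(a)|\notin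 W^{1,n}\big(U\cap(\Omega\setminus Z_{u-u(a)})\big)$ for every open set $U\subset\mathbb{R}^n$ containing $a$. 3. In particular, if $\log|u|\in W^{1,n}_{loc}(X\setminus Z_u)$, then $u$ is nowhere zero on $X$. -/

import Mathlib

open MeasureTheory
open scoped ENNReal NNReal ContDiff

/-- `f ∈ W^{1,p}(O)` for an open set `O ⊆ ℝⁿ`: `f ∈ L^p(O)`, and `f` has a weak gradient `g` on `O`
(tested against smooth functions with compact support in `O`) with `g ∈ L^p(O)`. -/
def MemW1p {n : ℕ} (p : ℝ≥0∞) (O : Set (EuclideanSpace ℝ (Fin n)))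
    (f : EuclideanSpace ℝ (Fin n) → ℝ) : Prop :=
  MemLp f p (volume.restrict O) ∧
  ∃ g : EuclideanSpace ℝ (Fin n) → EuclideanSpace ℝ (Fin n),
    MemLp g p (volume.restrict O) ∧
    ∀ φ : EuclideanSpace ℝ (Fin n) → ℝ, ContDiff ℝ ∞ φ → HasCompactSupport φ → tsupport φ ⊆ O →
      ∀ i : Fin n,
        ∫ x in O, f x * fderiv ℝ φ x (EuclideanSpace.single i 1) = - ∫ x in O, g x i * φ x

/-- Membership of an extended real valued function `f` in `W^{1,p}_loc` on `X ∖ Z`, local relative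
to `X`, where `X` is the open set `Ω` or its closure: `f` is finite almost everywhere on `Ω`, and
every point of `X` (points of `Z` included) has an open neighbourhood `U` in `ℝⁿ` with
`f ∈ W^{1,p}(U ∩ (Ω ∖ Z))`. -/
def MemW1pLocOff {n : ℕ} (p : ℝ≥0∞) (Ω X Z : Set (EuclideanSpace ℝ (Fin n)))
    (f : EuclideanSpace ℝ (Fin n) → EReal) : Prop :=
  (∀ᵐ x ∂(volume.restrict Ω), f x ≠ ⊥ ∧ f x ≠ ⊤) ∧
  ∀ x ∈ X, ∃ U : Set (EuclideanSpace ℝ (Fin n)), IsOpen U ∧ x ∈ U ∧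
    MemW1p p (U ∩ (Ω \ Z)) (fun y => (f y).toReal)

/-- The extended real number `log |t|`, with `log 0 = -∞`. -/
noncomputable def logAbs (t : ℝ) : EReal := ENNReal.log ‖t‖ₑ

theorem logAbs_zero : logAbs 0 = ⊥ := by simp [logAbs]

theorem logAbs_of_ne_zero {t : ℝ} (ht : t ≠ 0) : logAbs t = ((Real.log |t| : ℝ) : EReal) := by
  have h : ‖t‖ₑ ≠ 0 := by simpa using ht
  rw [logAbs, ENNReal.log_pos_real h (by simp)]
  simp

/-- `Ω` has Lipschitz boundary: near each boundary point `p`, in suitable orthonormal coordinates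
(with last axis along a unit vector `e`), `Ω` is the region strictly above the graph of a
Lipschitz function `γ` on the hyperplane orthogonal to `e`. -/
def HasLipschitzBoundary {n : ℕ} (Ω : Set (EuclideanSpace ℝ (Fin n))) : Prop :=
  ∀ p ∈ frontier Ω, ∃ (e : EuclideanSpace ℝ (Fin n)) (K : ℝ≥0)
    (γ : ((Submodule.span ℝ {e})ᗮ : Submodule ℝ (EuclideanSpace ℝ (Fin n))) → ℝ) (r : ℝ),
    ‖e‖ = 1 ∧ LipschitzWith K γ ∧ 0 < r ∧
    ∀ x ∈ Metric.ball p r,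
      x ∈ Ω ↔ γ ((Submodule.span ℝ {e})ᗮ.orthogonalProjectionOnto x) < inner ℝ e x

/-! The exponent `n` is critical for scaling: if `g ∈ L^n`, the oscillation it allows between the
means of a function over a set and over its half-size copy, about `r ^ (1 - n)` times the integral
of `‖g‖` over a set of size `r`, tends to `0` with `r`. But a Lipschitz `v` with `v a = 0` satisfies
`|v x| ≤ K * dist x a`, so an upper bound for `log |v|` drops by `log 2` at each halving. Means that
move by at most `log 2 / 2` per halving cannot follow, a contradiction
(`not_memW1p_log_abs_of_starConvex`).

The function `log |v|` is only controlled off the zeros of `v`, so the estimates are run on `log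
(max |v| c)`. These truncations are Lipschitz, and their derivatives are bounded by one `g ∈ L^n`
independent of `c` (`MemW1p.exists_truncation`). The oscillation bound is a Poincaré inequality on
convex sets.

The descent needs a convex set with vertex `a` on which the zeros of `v` are negligible. On a ball,
zeros of positive measure together with a nonzero value would make the truncations oscillate without
bound as `c → 0`, against Poincaré (`MemW1p.measure_zeros_eq_zero_or`). Connectedness of `Ω` near
`a` spreads this dichotomy, and a cone at `a` supplies the convex set. -/

open Set Filter Topology Metric

/-! ### Poincaré inequality on convex sets. -/

/-- The increment of a Lipschitz function is controlled by its derivative along a segment which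
meets the exceptional set in a null set. -/
theorem LipschitzWith.enorm_sub_le_lintegral_fderiv {E : Type*} [NormedAddCommGroup E]
    [NormedSpace ℝ E] {K : ℝ≥0} {W : E → ℝ} (hW : LipschitzWith K W) (x y : E)
    (h : ∀ᵐ t : ℝ, DifferentiableAt ℝ W (x + t • (y - x))) :
    ‖W y - W x‖ₑ ≤ ‖y - x‖ₑ * ∫⁻ t in Ioc (0 : ℝ) 1, ‖fderiv ℝ W (x + t • (y - x))‖ₑ := by
  set φ : ℝ → ℝ := fun t => W (x + t • (y - x)) with hφ
  have hl : LipschitzWith (K * ‖y - x‖₊) φ := by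
    refine hW.comp (LipschitzWith.of_dist_le_mul fun s t => ?_)
    rw [dist_add_left, dist_eq_norm, ← sub_smul, norm_smul, mul_comm]
    rfl
  have hac : AbsolutelyContinuousOnInterval φ 0 1 :=
    (hl.lipschitzOnWith (s := uIcc 0 1)).absolutelyContinuousOnInterval
  have hint := hac.integral_deriv_eq_sub
  rw [intervalIntegral.integral_of_le zero_le_one] at hint
  have h01 : W y - W x = φ 1 - φ 0 := by simp [hφ]
  rw [h01, ← hint, ← lintegral_const_mul' _ _ enorm_ne_top]
  refine (enorm_integral_le_lintegral_enorm _).trans (lintegral_mono_ae ?_)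
  filter_upwards [ae_restrict_of_ae h] with t ht
  have hd : HasDerivAt φ (fderiv ℝ W (x + t • (y - x)) (y - x)) t := by
    have h1 : HasDerivAt (fun s : ℝ => x + s • (y - x)) (y - x) t := by
      simpa using ((hasDerivAt_id t).smul_const (y - x)).const_add x
    exact ht.hasFDerivAt.comp_hasDerivAt t h1
  rw [hd.deriv, mul_comm]
  exact ContinuousLinearMap.le_opENorm _ _

section Poincare

variable {E : Type*} [NormedAddCommGroup E] [NormedSpace ℝ E] [FiniteDimensional ℝ E]
  [MeasurableSpace E] [BorelSpace E] (μ : Measure E) [μ.IsAddHaarMeasure]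

theorem lintegral_comp_homothety {f : E → ℝ≥0∞} (hf : Measurable f) (x : E) {t : ℝ}
    (ht : t ≠ 0) :
    ∫⁻ y, f (x + t • (y - x)) ∂μ
      = ENNReal.ofReal |(t ^ Module.finrank ℝ E)⁻¹| * ∫⁻ y, f y ∂μ := by
  have h1 := lintegral_sub_right_eq_self (μ := μ) (fun y => f (x + t • y)) x
  have h2 := lintegral_map (μ := μ) (f := fun y => f (x + y)) (g := fun y : E => t • y)
    (by fun_prop) (by fun_prop)
  rw [h1, ← h2, Measure.map_addHaar_smul μ ht, lintegral_smul_measure,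
    lintegral_add_left_eq_self, smul_eq_mul]

/-- For fixed `t ≠ 0` the homothety pulls null sets back to null sets; Fubini then exchanges `t` and
`y`. This makes Rademacher's theorem usable along almost every segment from `x`. -/
theorem ae_ae_comp_homothety {p : E → Prop} (hm : MeasurableSet {x | p x}) (hp : ∀ᵐ x ∂μ, p x)
    (x : E) : ∀ᵐ y ∂μ, ∀ᵐ t : ℝ, p (x + t • (y - x)) := by
  have hmeas : Measurable fun q : ℝ × E => x + q.1 • (q.2 - x) := by fun_prop
  rw [← Measure.ae_ae_comm (μ := (volume : Measure ℝ)) (ν := μ)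
    (p := fun t y => p (x + t • (y - x))) (hmeas hm)]
  have h0 : ∀ᵐ t : ℝ, t ≠ 0 := by simp [ae_iff]
  filter_upwards [h0] with t ht
  have h := lintegral_comp_homothety μ
    ((measurable_const (a := (1 : ℝ≥0∞))).indicator hm.compl) x ht
  rw [lintegral_indicator hm.compl, setLIntegral_one, show μ {x | p x}ᶜ = 0 from hp,
    mul_zero, lintegral_eq_zero_iff] at h
  · filter_upwards [h] with y hy
    by_contra hc
    simp [indicator, hc] at hy
  · exact ((measurable_const (a := (1 : ℝ≥0∞))).indicator hm.compl).comp (by fun_prop)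

/-- Convexity keeps the homothety with centre `x` inside `D`, and its Jacobian factor `t⁻¹ ^ N`
stays below `2 ^ N` because `t` is away from `0`. -/
theorem Convex.setLIntegral_comp_homothety_le {D : Set E} (hD : Convex ℝ D) (hDm : MeasurableSet D)
    {f : E → ℝ≥0∞} (hf : Measurable f) {x : E} (hx : x ∈ D) {t : ℝ} (ht : 1 / 2 ≤ t)
    (ht1 : t ≤ 1) :
    ∫⁻ y in D, f (x + t • (y - x)) ∂μ ≤ 2 ^ Module.finrank ℝ E * ∫⁻ y in D, f y ∂μ := by
  have ht0 : 0 < t := by linarith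
  rw [← lintegral_indicator hDm, ← lintegral_indicator hDm]
  calc ∫⁻ y, D.indicator (fun y => f (x + t • (y - x))) y ∂μ
      ≤ ∫⁻ y, D.indicator f (x + t • (y - x)) ∂μ := by
        refine lintegral_mono fun y => ?_
        by_cases hy : y ∈ D
        · rw [indicator_of_mem hy, indicator_of_mem (hD.add_smul_sub_mem hx hy ⟨ht0.le, ht1⟩)]
        · simp [hy]
    _ = ENNReal.ofReal |(t ^ Module.finrank ℝ E)⁻¹| * ∫⁻ y, D.indicator f y ∂μ :=
        lintegral_comp_homothety μ (hf.indicator hDm) x ht0.ne'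
    _ ≤ _ := by
        gcongr
        rw [abs_of_pos (by positivity), ← inv_pow,
          show (2 : ℝ≥0∞) = ENNReal.ofReal 2 by simp, ← ENNReal.ofReal_pow (by norm_num)]
        refine ENNReal.ofReal_le_ofReal (pow_le_pow_left₀ (by positivity) ?_ _)
        rw [inv_le_comm₀ ht0 (by norm_num)]
        linarith

/-- The segment is cut at its midpoint so that the Jacobian stays bounded: the half near `y` is
treated as a homothety centred at `x`, the half near `x` as one centred at `y`. -/
theorem Convex.lintegral_lintegral_segment_le {D : Set E} (hD : Convex ℝ D)
    (hDm : MeasurableSet D) {G : E → ℝ≥0∞} (hG : Measurable G) :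
    ∫⁻ x in D, ∫⁻ y in D, (∫⁻ t in Ioc (0 : ℝ) 1, G (x + t • (y - x))) ∂μ ∂μ
      ≤ 2 ^ (Module.finrank ℝ E + 1) * (μ D * ∫⁻ y in D, G y ∂μ) := by
  set A := ∫⁻ y in D, G y ∂μ
  set N := Module.finrank ℝ E
  have hI (a b : ℝ) : Measurable fun q : E × E =>
      ∫⁻ t in Ioc a b, G (q.1 + t • (q.2 - q.1)) := by
    refine Measurable.lintegral_prod_right' (f := fun r : (E × E) × ℝ =>
      G (r.1.1 + r.2 • (r.1.2 - r.1.1))) (hG.comp (by fun_prop))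
  have h2 : ∫⁻ x in D, ∫⁻ y in D, (∫⁻ t in Ioc (1 / 2 : ℝ) 1, G (x + t • (y - x))) ∂μ ∂μ
      ≤ 2 ^ N * (μ D * A) := by
    calc _ ≤ ∫⁻ x in D, 2 ^ N * A ∂μ := by
          refine setLIntegral_mono' hDm fun x hx => ?_
          have hm : Measurable (Function.uncurry fun (y : E) (t : ℝ) => G (x + t • (y - x))) :=
            hG.comp (g := G) (f := fun q : E × ℝ => x + q.2 • (q.1 - x)) (by fun_prop)
          rw [lintegral_lintegral_swap hm.aemeasurable]
          calc _ ≤ ∫⁻ t in Ioc (1 / 2 : ℝ) 1, 2 ^ N * A :=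
                setLIntegral_mono' measurableSet_Ioc fun t ht =>
                  hD.setLIntegral_comp_homothety_le μ hDm hG hx ht.1.le ht.2
            _ ≤ _ := by
                rw [setLIntegral_const]
                refine mul_le_of_le_one_right' ?_
                rw [Real.volume_Ioc]
                exact ENNReal.ofReal_le_one.2 (by norm_num)
      _ = _ := by rw [setLIntegral_const]; ring
  have h1 : ∫⁻ x in D, ∫⁻ y in D, (∫⁻ t in Ioc (0 : ℝ) (1 / 2), G (x + t • (y - x))) ∂μ ∂μ
      ≤ 2 ^ N * (μ D * A) := by
    rw [lintegral_lintegral_swap (hI 0 (1 / 2)).aemeasurable]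
    calc _ ≤ ∫⁻ y in D, 2 ^ N * A ∂μ := by
          refine setLIntegral_mono' hDm fun y hy => ?_
          have hm : Measurable (Function.uncurry fun (x : E) (t : ℝ) => G (x + t • (y - x))) :=
            hG.comp (g := G) (f := fun q : E × ℝ => q.1 + q.2 • (y - q.1)) (by fun_prop)
          rw [lintegral_lintegral_swap hm.aemeasurable]
          calc _ ≤ ∫⁻ t in Ioc (0 : ℝ) (1 / 2), 2 ^ N * A := by
                refine setLIntegral_mono' measurableSet_Ioc fun t ht => ?_
                -- The same point seen from `y`: `x + t • (y - x) = y + (1 - t) • (x - y)`, with `1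
                -- - t ≥ 1 / 2`.
                have h := hD.setLIntegral_comp_homothety_le μ hDm hG hy (t := 1 - t)
                  (by linarith [ht.2]) (by linarith [ht.1])
                refine le_trans (le_of_eq ?_) h
                refine lintegral_congr fun x => congrArg G ?_
                module
            _ ≤ _ := by
                rw [setLIntegral_const]
                refine mul_le_of_le_one_right' ?_
                rw [Real.volume_Ioc]
                exact ENNReal.ofReal_le_one.2 (by norm_num)
      _ = _ := by rw [setLIntegral_const]; ring
  have hsplit (x y : E) : ∫⁻ t in Ioc (0 : ℝ) 1, G (x + t • (y - x))
      = (∫⁻ t in Ioc (0 : ℝ) (1 / 2), G (x + t • (y - x))) +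
        ∫⁻ t in Ioc (1 / 2 : ℝ) 1, G (x + t • (y - x)) := by
    rw [← Ioc_union_Ioc_eq_Ioc (show (0 : ℝ) ≤ 1 / 2 by norm_num) (by norm_num),
      lintegral_union measurableSet_Ioc (Ioc_disjoint_Ioc_of_le le_rfl)]
  have hy (x : E) : Measurable fun y =>
      ∫⁻ t in Ioc (0 : ℝ) (1 / 2), G (x + t • (y - x)) :=
    (hI 0 (1 / 2)).comp measurable_prodMk_left
  simp_rw [hsplit, lintegral_add_left (hy _)]
  rw [lintegral_add_left (hI 0 (1 / 2)).lintegral_prod_right']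
  calc _ ≤ 2 ^ N * (μ D * A) + 2 ^ N * (μ D * A) := add_le_add h1 h2
    _ = _ := by rw [pow_succ]; ring

/-- **Poincaré inequality** on a bounded convex set, in its double integral form. -/
theorem LipschitzWith.lintegral_lintegral_enorm_sub_le {K : ℝ≥0} {W : E → ℝ}
    (hW : LipschitzWith K W) {D : Set E} (hD : Convex ℝ D) (hDm : MeasurableSet D) {d : ℝ≥0∞}
    (hd : ∀ x ∈ D, ∀ y ∈ D, ‖y - x‖ₑ ≤ d) (hd' : d ≠ ⊤) :
    ∫⁻ x in D, ∫⁻ y in D, ‖W y - W x‖ₑ ∂μ ∂μ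
      ≤ d * (2 ^ (Module.finrank ℝ E + 1) * (μ D * ∫⁻ y in D, ‖fderiv ℝ W y‖ₑ ∂μ)) := by
  refine le_trans ?_ (mul_le_mul_right
    (hD.lintegral_lintegral_segment_le μ hDm (measurable_fderiv ℝ W).enorm) d)
  rw [← lintegral_const_mul' _ _ hd']
  refine setLIntegral_mono' hDm fun x hx => ?_
  rw [← lintegral_const_mul' _ _ hd']
  refine lintegral_mono_ae ?_
  filter_upwards [ae_restrict_of_ae (ae_ae_comp_homothety μ
    (measurableSet_of_differentiableAt ℝ W) (hW.ae_differentiableAt (μ := μ)) x),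
    ae_restrict_mem hDm] with y hy hyD
  refine (hW.enorm_sub_le_lintegral_fderiv x y hy).trans ?_
  gcongr
  exact hd x hx y hyD

end Poincare

/-- Comparison of the means of a function over two sets by its double oscillation. -/
theorem enorm_setAverage_sub_setAverage_le {E : Type*} [MeasurableSpace E] (μ : Measure E)
    {W : E → ℝ} {A B : Set E}
    (hA : IntegrableOn W A μ) (hB : IntegrableOn W B μ) (hA0 : μ A ≠ 0) (hA1 : μ A ≠ ⊤)
    (hB0 : μ B ≠ 0) (hB1 : μ B ≠ ⊤) :
    ‖(⨍ x in B, W x ∂μ) - ⨍ x in A, W x ∂μ‖ₑ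
      ≤ (μ A)⁻¹ * ((μ B)⁻¹ * ∫⁻ x in A, ∫⁻ y in B, ‖W y - W x‖ₑ ∂μ ∂μ) := by
  have hAr : μ.real A ≠ 0 := by simp [Measure.real, ENNReal.toReal_eq_zero_iff, hA0, hA1]
  have hBr : μ.real B ≠ 0 := by simp [Measure.real, ENNReal.toReal_eq_zero_iff, hB0, hB1]
  have key : (⨍ x in B, W x ∂μ) - ⨍ x in A, W x ∂μ
      = (μ.real A)⁻¹ * ∫ x in A, (μ.real B)⁻¹ * ∫ y in B, (W y - W x) ∂μ ∂μ := by
    have h (x : E) : (μ.real B)⁻¹ * ∫ y in B, (W y - W x) ∂μ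
        = (⨍ y in B, W y ∂μ) - W x := by
      rw [integral_sub hB.integrable (integrableOn_const (C := W x) hB1), setIntegral_const, setAverage_eq, smul_eq_mul,
        smul_eq_mul]
      field_simp
    simp_rw [h]
    rw [integral_sub (integrableOn_const (C := ⨍ y in B, W y ∂μ) hA1) hA.integrable, setIntegral_const, setAverage_eq (s := A),
      smul_eq_mul, smul_eq_mul]
    field_simp
  have hinv {S : Set E} (h0 : μ S ≠ 0) (h1 : μ S ≠ ⊤) : ‖(μ.real S)⁻¹‖ₑ = (μ S)⁻¹ := by
    rw [enorm_inv (by simp [Measure.real, ENNReal.toReal_eq_zero_iff, h0, h1]),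
      Real.enorm_eq_ofReal measureReal_nonneg, ofReal_measureReal h1]
  rw [key, enorm_mul, hinv hA0 hA1]
  gcongr
  refine (enorm_integral_le_lintegral_enorm _).trans ?_
  rw [← lintegral_const_mul' _ _ (ENNReal.inv_ne_top.2 hB0)]
  refine lintegral_mono fun x => ?_
  rw [enorm_mul, hinv hB0 hB1]
  gcongr
  exact enorm_integral_le_lintegral_enorm _

/-! ### Weak gradients and logarithmic truncations. -/

section WeakGradient

variable {n : ℕ}

theorem norm_eq_of_forall_apply_single_eq
    (L : EuclideanSpace ℝ (Fin n) →L[ℝ] ℝ) (w : EuclideanSpace ℝ (Fin n))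
    (h : ∀ i, L (EuclideanSpace.single i 1) = w i) : ‖L‖ = ‖w‖ := by
  have hL : L = innerSL ℝ w := by
    apply ContinuousLinearMap.coe_injective
    refine (EuclideanSpace.basisFun (Fin n) ℝ).toBasis.ext fun i => ?_
    simp [h i, EuclideanSpace.inner_single_right]
  rw [hL, innerSL_apply_norm]

/-- A Lipschitz function which agrees on an open set with a function having a weak gradient
there has its classical derivative bounded by the weak gradient. -/
theorem LipschitzWith.ae_norm_fderiv_le_of_weak_gradient {K : ℝ≥0}
    {W f : EuclideanSpace ℝ (Fin n) → ℝ} (hW : LipschitzWith K W)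
    {O P : Set (EuclideanSpace ℝ (Fin n))} (hO : MeasurableSet O) (hP : IsOpen P) (hPO : P ⊆ O)
    (hWf : EqOn W f P) {g : EuclideanSpace ℝ (Fin n) → EuclideanSpace ℝ (Fin n)} {p : ℝ≥0∞}
    (hp : 1 ≤ p) (hg : MemLp g p (volume.restrict O))
    (hfg : ∀ φ : EuclideanSpace ℝ (Fin n) → ℝ, ContDiff ℝ ∞ φ → HasCompactSupport φ →
      tsupport φ ⊆ O → ∀ i : Fin n,
        ∫ x in O, f x * fderiv ℝ φ x (EuclideanSpace.single i 1) = - ∫ x in O, g x i * φ x) :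
    ∀ᵐ x, x ∈ P → ‖fderiv ℝ W x‖ ≤ ‖g x‖ := by
  have hcoord (i : Fin n) : ∀ᵐ x, x ∈ P →
      lineDeriv ℝ W x (EuclideanSpace.single i 1) - O.indicator (fun y => g y i) x = 0 := by
    have hloc : LocallyIntegrable (O.indicator fun y => g y i) := by
      refine MemLp.locallyIntegrable (p := p) ?_ hp
      rw [memLp_indicator_iff_restrict hO]
      exact (EuclideanSpace.proj (𝕜 := ℝ) i).comp_memLp' hg
    have hlocd := hW.locallyIntegrable_lineDeriv (μ := volume)
      (EuclideanSpace.single i (1 : ℝ))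
    refine hP.ae_eq_zero_of_integral_contDiff_smul_eq_zero
      ((hlocd.sub hloc).locallyIntegrableOn P) fun φ hφ hφc hφP => ?_
    obtain ⟨D, hD⟩ := ContDiff.lipschitzWith_of_hasCompactSupport hφc hφ (by simp)
    have hparts := hW.integral_lineDeriv_mul_eq (μ := volume) hD hφc
      (EuclideanSpace.single i (1 : ℝ))
    have hline (x) : lineDeriv ℝ φ x (-EuclideanSpace.single i (1 : ℝ))
        = -fderiv ℝ φ x (EuclideanSpace.single i 1) := by
      rw [((hφ.differentiable (by simp)) x).lineDeriv_eq_fderiv, map_neg]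
    have h1 : ∫ x, φ x * lineDeriv ℝ W x (EuclideanSpace.single i 1)
        = ∫ x in O, g x i * φ x := by
      rw [← neg_eq_iff_eq_neg.2 (hfg φ hφ hφc (hφP.trans hPO) i), ← integral_indicator hO,
        ← integral_neg]
      simp_rw [mul_comm (φ _)]
      rw [hparts]
      refine integral_congr_ae (.of_forall fun x => ?_)
      by_cases hx : x ∈ P
      · simp only [hline, indicator_of_mem (hPO hx), hWf hx]
        ring
      -- Off `P` the functions `W` and `f` may differ, but the derivative of the test function
      -- vanishes there.
      · have h0 : fderiv ℝ φ x = 0 := by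
          have : x ∉ tsupport (fderiv ℝ φ) := fun h => hx (hφP (tsupport_fderiv_subset ℝ h))
          exact image_eq_zero_of_notMem_tsupport this
        simp [hline, h0, indicator]
    have h2 : ∫ x, φ x * O.indicator (fun y => g y i) x = ∫ x in O, g x i * φ x := by
      rw [← integral_indicator hO]
      refine integral_congr_ae (.of_forall fun x => ?_)
      by_cases hx : x ∈ O <;> simp [hx, mul_comm]
    simp only [smul_eq_mul, mul_sub]
    rw [integral_sub, h1, h2, sub_self]
    · exact hlocd.integrable_smul_left_of_hasCompactSupport hφ.continuous hφc
    · exact hloc.integrable_smul_left_of_hasCompactSupport hφ.continuous hφc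
  filter_upwards [ae_all_iff.2 hcoord, hW.ae_differentiableAt (μ := volume)] with x hx hd hxP
  refine (norm_eq_of_forall_apply_single_eq _ _ fun i => ?_).le
  have h := hx i hxP
  rw [indicator_of_mem (hPO hxP), hd.lineDeriv_eq_fderiv] at h
  linarith

end WeakGradient

theorem lipschitzOnWith_log_Ici {c : ℝ} (hc : 0 < c) :
    LipschitzOnWith (Real.toNNReal c⁻¹) Real.log (Ici c) := by
  refine LipschitzOnWith.of_le_add_mul _ fun s hs t ht => ?_
  have ht0 : 0 < t := hc.trans_le ht
  have hs0 : 0 < s := hc.trans_le hs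
  rw [Real.coe_toNNReal _ (inv_nonneg.2 hc.le), Real.dist_eq, ← sub_le_iff_le_add',
    ← Real.log_div hs0.ne' ht0.ne']
  calc Real.log (s / t) ≤ s / t - 1 := Real.log_le_sub_one_of_pos (by positivity)
    _ = t⁻¹ * (s - t) := by field_simp
    _ ≤ t⁻¹ * |s - t| := by gcongr; exact le_abs_self _
    _ ≤ c⁻¹ * |s - t| := by gcongr; exact ht

/-- The truncation is Lipschitz on `V` since `log` is Lipschitz on `[c, ∞)`. Extending it to the
whole space makes the global Rademacher theorem and integration by parts available. -/
theorem LipschitzOnWith.exists_lipschitzWith_log_max {E : Type*} [PseudoMetricSpace E] {K : ℝ≥0}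
    {v : E → ℝ} {V : Set E} (hv : LipschitzOnWith K v V) {c : ℝ} (hc : 0 < c) :
    ∃ (K' : ℝ≥0) (W : E → ℝ), LipschitzWith K' W ∧ ∀ x ∈ V, W x = Real.log (max |v x| c) := by
  have h1 : LipschitzWith 1 fun t : ℝ => max |t| c := by
    simpa using (lipschitzWith_one_norm (E := ℝ)).max_const c
  have h2 := (lipschitzOnWith_log_Ici hc).comp ((h1.lipschitzOnWith (s := univ)).comp hv
    (mapsTo_univ _ _)) fun x _ => le_max_right |v x| c
  obtain ⟨W, hW, hWe⟩ := h2.extend_real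
  exact ⟨_, W, hW, fun x hx => (hWe hx).symm⟩

/-- If `log |v|` has a weak gradient in `L^p` off the zero set of `v`, then the truncations
`log (max |v| c)` have their derivatives bounded by one function in `L^p`. -/
theorem MemW1p.exists_truncation {n : ℕ} {p : ℝ≥0∞} (hp : 1 ≤ p)
    {V : Set (EuclideanSpace ℝ (Fin n))} (hV : IsOpen V) {K : ℝ≥0}
    {v : EuclideanSpace ℝ (Fin n) → ℝ} (hv : LipschitzOnWith K v V)
    (h : MemW1p p (V \ {x | v x = 0}) fun x => Real.log |v x|) :
    ∃ g : EuclideanSpace ℝ (Fin n) → EuclideanSpace ℝ (Fin n), MemLp g p ∧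
      ∀ c : ℝ, 0 < c → ∃ (K' : ℝ≥0) (W : EuclideanSpace ℝ (Fin n) → ℝ), LipschitzWith K' W ∧
        (∀ x ∈ V, W x = Real.log (max |v x| c)) ∧ ∀ᵐ x, x ∈ V → ‖fderiv ℝ W x‖ ≤ ‖g x‖ := by
  obtain ⟨-, g, hg, hfg⟩ := h
  have hopen (c : ℝ) : IsOpen {x | x ∈ V ∧ c < |v x|} :=
    hv.continuousOn.abs.isOpen_inter_preimage hV isOpen_Ioi
  have hO : MeasurableSet (V \ {x | v x = 0}) := by
    convert (hopen 0).measurableSet using 1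
    ext x
    simp
  refine ⟨(V \ {x | v x = 0}).indicator g, (memLp_indicator_iff_restrict hO).2 hg,
    fun c hc => ?_⟩
  obtain ⟨K', W, hW, hWe⟩ := hv.exists_lipschitzWith_log_max hc
  refine ⟨K', W, hW, hWe, ?_⟩
  have hsub : {x | x ∈ V ∧ c < |v x|} ⊆ V \ {x | v x = 0} := fun x hx =>
    ⟨hx.1, fun h0 => by
      have := hx.2
      rw [show v x = 0 from h0, abs_zero] at this
      linarith⟩
  have hmain := hW.ae_norm_fderiv_le_of_weak_gradient hO (hopen c) hsub
    (f := fun x => Real.log |v x|) (fun x hx => by rw [hWe x hx.1, max_eq_left hx.2.le]) hp hg hfg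
  filter_upwards [hmain] with x hx hxV
  by_cases hxc : c < |v x|
  · rw [indicator_of_mem (hsub ⟨hxV, hxc⟩)]
    exact hx ⟨hxV, hxc⟩
  -- Where `|v x| ≤ c` the truncation takes its least value `log c`, so its derivative vanishes and
  -- no information on `g` is needed.
  · have hmin : IsLocalMin W x := by
      filter_upwards [hV.mem_nhds hxV] with y hy
      rw [hWe x hxV, hWe y hy, max_eq_right (not_lt.1 hxc)]
      exact Real.log_le_log hc (le_max_right _ _)
    rw [hmin.fderiv_eq_zero, norm_zero]
    exact norm_nonneg _

/-! ### Dichotomy for the zero set. -/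

/-- If `log |v|` is a Sobolev function off the zero set of `v`, then on a convex set `v` vanishes
either almost nowhere or everywhere. -/
theorem MemW1p.measure_zeros_eq_zero_or {n : ℕ} {p : ℝ≥0∞} (hp : 1 ≤ p)
    {V : Set (EuclideanSpace ℝ (Fin n))} (hV : IsOpen V) {K : ℝ≥0}
    {v : EuclideanSpace ℝ (Fin n) → ℝ} (hv : LipschitzOnWith K v V)
    (h : MemW1p p (V \ {x | v x = 0}) fun x => Real.log |v x|)
    {B : Set (EuclideanSpace ℝ (Fin n))} (hB : IsOpen B) (hBc : Convex ℝ B)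
    (hBb : Bornology.IsBounded B) (hBV : B ⊆ V) :
    volume (B ∩ {x | v x = 0}) = 0 ∨ ∀ x ∈ B, v x = 0 := by
  obtain ⟨g, hg, hT⟩ := h.exists_truncation hp hV hv
  by_contra! hcon
  obtain ⟨hZ, x₀, hx₀, hvx₀⟩ := hcon
  set Z := B ∩ {x | v x = 0}
  have hZm : MeasurableSet Z := by
    have : IsOpen {x | x ∈ B ∧ v x ∈ ({0}ᶜ : Set ℝ)} :=
      (hv.continuousOn.mono hBV).isOpen_inter_preimage hB isOpen_compl_singleton
    convert hB.measurableSet.diff this.measurableSet using 1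
    ext x
    simp [Z]
  set b := |v x₀| / 2
  have hb : 0 < b := by positivity
  set F : Set (EuclideanSpace ℝ (Fin n)) := {x | x ∈ B ∧ b < |v x|}
  have hF : IsOpen F := (hv.continuousOn.mono hBV).abs.isOpen_inter_preimage hB isOpen_Ioi
  have hF0 : volume F ≠ 0 :=
    (hF.measure_pos volume ⟨x₀, hx₀, half_lt_self (by positivity)⟩).ne'
  have hBfin : volume B < ⊤ := hBb.measure_lt_top
  obtain ⟨d, hd⟩ := hBb.exists_norm_le
  -- The Poincaré bound with `g` in place of the derivative, hence independent of the truncation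
  -- level.
  set C : ℝ≥0∞ := ENNReal.ofReal (d + d) * (2 ^ (Module.finrank ℝ (EuclideanSpace ℝ (Fin n)) + 1)
    * (volume B * ∫⁻ x in B, ‖g x‖ₑ))
  have hC : C ≠ ⊤ := by
    have : IsFiniteMeasure (volume.restrict B) := ⟨by simpa using hBfin⟩
    have h1 : ∫⁻ x in B, ‖g x‖ₑ ≠ ⊤ :=
      ((hg.restrict B).integrable hp).hasFiniteIntegral.ne
    finiteness
  have key (m : ℕ) : (m : ℝ≥0∞) * (volume Z * volume F) ≤ C := by
    -- At this level the truncation equals `log b - m` on `Z` and is at least `log b` on `F`, a gap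
    -- of at least `m`.
    set c := b * Real.exp (-m)
    have hc : 0 < c := by positivity
    have hcb : c ≤ b := mul_le_of_le_one_right hb.le (by simp)
    obtain ⟨K', W, hW, hWe, hWd⟩ := hT c hc
    have hle := hW.lintegral_lintegral_enorm_sub_le volume hBc hB.measurableSet
      (d := ENNReal.ofReal (d + d)) (fun x hx y hy => by
        rw [← ofReal_norm]
        refine ENNReal.ofReal_le_ofReal ((norm_sub_le _ _).trans ?_)
        exact add_le_add (hd y hy) (hd x hx)) ENNReal.ofReal_ne_top
    have hgrad : ∫⁻ x in B, ‖fderiv ℝ W x‖ₑ ≤ ∫⁻ x in B, ‖g x‖ₑ := by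
      refine lintegral_mono_ae ?_
      filter_upwards [ae_restrict_of_ae hWd, ae_restrict_mem hB.measurableSet] with x hx hxB
      exact enorm_le_iff_norm_le.2 (hx (hBV hxB))
    calc (m : ℝ≥0∞) * (volume Z * volume F)
        = ∫⁻ x in Z, ∫⁻ y in F, (m : ℝ≥0∞) := by
          rw [setLIntegral_const, setLIntegral_const]
          ring
      _ ≤ ∫⁻ x in Z, ∫⁻ y in F, ‖W y - W x‖ₑ := by
          refine setLIntegral_mono' hZm fun x hx => setLIntegral_mono' hF.measurableSet
            fun y hy => ?_
          have hx0 : v x = 0 := hx.2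
          rw [hWe x (hBV hx.1), hWe y (hBV hy.1), hx0, abs_zero, max_eq_right hc.le,
            max_eq_left (hcb.trans hy.2.le), ← ofReal_norm]
          rw [← ENNReal.ofReal_natCast m]
          refine ENNReal.ofReal_le_ofReal ((?_ : (m : ℝ) ≤ _).trans (le_abs_self _))
          have h1 : Real.log c = Real.log b - m := by
            rw [Real.log_mul hb.ne' (Real.exp_pos _).ne', Real.log_exp]; ring
          have h2 := Real.log_le_log hb hy.2.le
          linarith
      _ ≤ ∫⁻ x in B, ∫⁻ y in B, ‖W y - W x‖ₑ :=
          (lintegral_mono fun x => lintegral_mono_set fun y hy => hy.1).trans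
            (lintegral_mono_set inter_subset_left)
      _ ≤ _ := hle.trans (by simp only [C]; gcongr)
  have hpos : volume Z * volume F ≠ 0 := mul_ne_zero hZ hF0
  obtain ⟨m, hm⟩ := ENNReal.exists_nat_mul_gt hpos hC
  exact absurd (key m) (not_le.2 hm)

/-! ### Means over dyadic contractions. -/

/-- The factor `μ A` in the Poincaré inequality cancels the averaging over `A`, so only the inverse
measure of the smaller set `B` remains. -/
theorem LipschitzWith.abs_setAverage_sub_setAverage_le {E F : Type*} [NormedAddCommGroup E]
    [NormedSpace ℝ E] [FiniteDimensional ℝ E] [MeasurableSpace E] [BorelSpace E] (μ : Measure E)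
    [μ.IsAddHaarMeasure] [NormedAddCommGroup F] {K : ℝ≥0} {W : E → ℝ} (hW : LipschitzWith K W)
    {A B : Set E} (hA : Convex ℝ A) (hAo : IsOpen A) (hBo : IsOpen B) (hB : B.Nonempty)
    (hBA : B ⊆ A) {a : E} {r : ℝ} (hAr : A ⊆ closedBall a r) {g : E → F}
    (hg : IntegrableOn g A μ) (hWg : ∀ᵐ x ∂μ, x ∈ A → ‖fderiv ℝ W x‖ ≤ ‖g x‖) :
    |(⨍ x in B, W x ∂μ) - ⨍ x in A, W x ∂μ|
      ≤ (μ.real B)⁻¹ * (2 * r * (2 ^ (Module.finrank ℝ E + 1) * ∫ x in A, ‖g x‖ ∂μ)) := by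
  have hAb : Bornology.IsBounded A := isBounded_closedBall.subset hAr
  have hA1 : μ A ≠ ⊤ := hAb.measure_lt_top.ne
  have hB1 : μ B ≠ ⊤ := (hAb.subset hBA).measure_lt_top.ne
  have hB0 : μ B ≠ 0 := (hBo.measure_pos μ hB).ne'
  have hA0 : μ A ≠ 0 := (hAo.measure_pos μ (hB.mono hBA)).ne'
  have hr : 0 ≤ r := by
    obtain ⟨x, hx⟩ := hB
    exact dist_nonneg.trans (hAr (hBA hx))
  have hWi {S : Set E} (hS : S ⊆ A) : IntegrableOn W S μ :=
    (hW.continuous.continuousOn.integrableOn_compact (isCompact_closedBall a r)).mono_set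
      (hS.trans hAr)
  have h1 := enorm_setAverage_sub_setAverage_le μ (hWi le_rfl) (hWi hBA) hA0 hA1 hB0 hB1
  have h2 := hW.lintegral_lintegral_enorm_sub_le μ hA hAo.measurableSet
    (d := ENNReal.ofReal (2 * r)) (fun x hx y hy => by
      rw [← ofReal_norm, ← dist_eq_norm]
      refine ENNReal.ofReal_le_ofReal ((dist_triangle_right y x a).trans ?_)
      have hx' := mem_closedBall.1 (hAr hx)
      have hy' := mem_closedBall.1 (hAr hy)
      linarith) ENNReal.ofReal_ne_top
  have h3 : ∫⁻ x in A, ‖fderiv ℝ W x‖ₑ ∂μ ≤ ENNReal.ofReal (∫ x in A, ‖g x‖ ∂μ) := by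
    rw [ofReal_integral_norm_eq_lintegral_enorm hg]
    refine lintegral_mono_ae ?_
    filter_upwards [ae_restrict_of_ae hWg, ae_restrict_mem hAo.measurableSet] with x hx hxA
    exact enorm_le_iff_norm_le.2 (hx hxA)
  have h4 : ∫⁻ x in A, ∫⁻ y in B, ‖W y - W x‖ₑ ∂μ ∂μ
      ≤ ∫⁻ x in A, ∫⁻ y in A, ‖W y - W x‖ₑ ∂μ ∂μ :=
    lintegral_mono fun x => lintegral_mono_set hBA
  have hI : 0 ≤ ∫ x in A, ‖g x‖ ∂μ := integral_nonneg fun x => norm_nonneg _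
  have hBr : 0 < μ.real B := ENNReal.toReal_pos hB0 hB1
  rw [← ENNReal.ofReal_le_ofReal_iff (by positivity), ← Real.norm_eq_abs, ofReal_norm]
  calc _ ≤ (μ A)⁻¹ * ((μ B)⁻¹ * (ENNReal.ofReal (2 * r) * (2 ^ (Module.finrank ℝ E + 1) *
          (μ A * ENNReal.ofReal (∫ x in A, ‖g x‖ ∂μ))))) := by
        refine h1.trans ?_
        gcongr
        exact h4.trans (h2.trans (by gcongr))
    _ = (μ A)⁻¹ * μ A * ((μ B)⁻¹ * (ENNReal.ofReal (2 * r) * (2 ^ (Module.finrank ℝ E + 1) *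
          ENNReal.ofReal (∫ x in A, ‖g x‖ ∂μ)))) := by ring
    _ = _ := by
        rw [ENNReal.inv_mul_cancel hA0 hA1, one_mul,
          ENNReal.ofReal_mul (p := (μ.real B)⁻¹) (by positivity),
          ENNReal.ofReal_mul (p := 2 * r) (by positivity),
          ENNReal.ofReal_mul (p := 2 ^ (Module.finrank ℝ E + 1)) (by positivity),
          ENNReal.ofReal_inv_of_pos hBr, ofReal_measureReal hB1,
          ENNReal.ofReal_pow (by norm_num), ENNReal.ofReal_ofNat]

/-- A weighted Young-type bound taking the place of Hölder's inequality: either `s ≤ t⁻¹`, or `t * s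
≥ 1` and its powers may be inserted. -/
theorem le_inv_add_pow_mul_pow_succ {s t : ℝ} (hs : 0 ≤ s) (ht : 0 < t) (k : ℕ) :
    s ≤ t⁻¹ + t ^ k * s ^ (k + 1) := by
  rcases le_total s t⁻¹ with h | h
  · have : 0 ≤ t ^ k * s ^ (k + 1) := by positivity
    linarith
  · have h1 : 1 ≤ t * s := by
      calc (1 : ℝ) = t * t⁻¹ := (mul_inv_cancel₀ ht.ne').symm
        _ ≤ t * s := by gcongr
    have h2 : s * 1 ≤ s * (t * s) ^ k := by
      gcongr
      exact one_le_pow₀ h1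
    have h3 : s * (t * s) ^ k = t ^ k * s ^ (k + 1) := by ring
    have : 0 < t⁻¹ := inv_pos.2 ht
    linarith

/-- For `g ∈ L^n(ℝⁿ)`, the integrals of `‖g‖` over the dyadic contractions `D j` of a set are
`o(2 ^ (-j (n - 1)))`. -/
theorem MemLp.eventually_setIntegral_norm_le {E F : Type*} [NormedAddCommGroup E]
    [NormedSpace ℝ E] [FiniteDimensional ℝ E] [MeasurableSpace E] [BorelSpace E] (μ : Measure E)
    [μ.IsAddHaarMeasure] [NormedAddCommGroup F] (hn : 1 ≤ Module.finrank ℝ E) {g : E → F}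
    (hg : MemLp g (Module.finrank ℝ E) μ) {D : ℕ → Set E} {M : ℝ} (hM : 0 < M)
    (hDμ : ∀ j, μ.real (D j) = (2⁻¹ ^ j) ^ Module.finrank ℝ E * M)
    (hDb : ∀ j, μ (D j) ≠ ⊤) {ε : ℝ} (hε : 0 < ε) :
    ∀ᶠ j in atTop, (∫ x in D j, ‖g x‖ ∂μ)
      ≤ ε * (2⁻¹ ^ j) ^ (Module.finrank ℝ E - 1) := by
  obtain ⟨k, hk⟩ : ∃ k, Module.finrank ℝ E = k + 1 := ⟨_, (Nat.sub_add_cancel hn).symm⟩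
  rw [hk] at hg hDμ ⊢
  rw [Nat.add_sub_cancel]
  have hgp : Integrable (fun x => ‖g x‖ ^ (k + 1)) μ := hg.integrable_norm_pow (by simp)
  have hto : Tendsto (fun j => ∫ x in D j, ‖g x‖ ^ (k + 1) ∂μ) atTop (𝓝 0) := by
    refine hgp.tendsto_setIntegral_nhds_zero ?_
    have h0 : Tendsto (fun j : ℕ => ENNReal.ofReal (((2 : ℝ)⁻¹ ^ j) ^ (k + 1) * M)) atTop
        (𝓝 0) := by
      have : Tendsto (fun j : ℕ => ((2 : ℝ)⁻¹ ^ j) ^ (k + 1) * M) atTop (𝓝 0) := by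
        have h := ((tendsto_pow_atTop_nhds_zero_of_lt_one (r := (2 : ℝ)⁻¹) (by norm_num)
          (by norm_num)).pow (k + 1)).mul_const M
        simpa using h
      simpa using ENNReal.tendsto_ofReal this
    refine h0.congr fun j => ?_
    rw [Function.comp_apply, ← hDμ, ofReal_measureReal (hDb j)]
  -- With weight `τ * r`, the constant term integrates to exactly `ε / 2 * r ^ k`; the threshold
  -- below gives the other half.
  set τ := 2 * M / ε
  have hτ : 0 < τ := by positivity
  filter_upwards [hto.eventually (ge_mem_nhds (show 0 < ε / 2 / τ ^ k by positivity))] with j hj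
  set r : ℝ := 2⁻¹ ^ j
  have hr : 0 < r := by positivity
  have : IsFiniteMeasure (μ.restrict (D j)) := ⟨by simpa using (hDb j).lt_top⟩
  have hgi : Integrable (fun x => ‖g x‖) (μ.restrict (D j)) :=
    ((hg.restrict (D j)).integrable (by simp)).norm
  calc ∫ x in D j, ‖g x‖ ∂μ ≤ ∫ x in D j, ((τ * r)⁻¹ + (τ * r) ^ k * ‖g x‖ ^ (k + 1)) ∂μ :=
        integral_mono hgi ((integrable_const _).add (hgp.restrict.const_mul _)) fun x =>
          le_inv_add_pow_mul_pow_succ (norm_nonneg _) (by positivity) k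
    _ = r ^ (k + 1) * M * (τ * r)⁻¹
        + (τ * r) ^ k * ∫ x in D j, ‖g x‖ ^ (k + 1) ∂μ := by
        rw [integral_add (integrable_const _) (hgp.restrict.const_mul _), setIntegral_const,
          integral_const_mul, hDμ, smul_eq_mul]
    _ ≤ r ^ (k + 1) * M * (τ * r)⁻¹ + (τ * r) ^ k * (ε / 2 / τ ^ k) := by gcongr
    _ = ε * r ^ k := by
        simp only [τ]
        field_simp
        ring

/-- A Lipschitz function `v` vanishing at `a` cannot have `log |v|` in `W^{1,n}` on a convex set
with vertex `a` in which its zeros are negligible. -/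
theorem not_memW1p_log_abs_of_starConvex {n : ℕ} (hn : 1 ≤ n)
    {V : Set (EuclideanSpace ℝ (Fin n))} (hV : IsOpen V) {K : ℝ≥0}
    {v : EuclideanSpace ℝ (Fin n) → ℝ} (hv : LipschitzOnWith K v V)
    {a : EuclideanSpace ℝ (Fin n)} (hva : ∀ x ∈ V, |v x| ≤ K * dist x a)
    {D : Set (EuclideanSpace ℝ (Fin n))} (hD : IsOpen D) (hDc : Convex ℝ D) (hDn : D.Nonempty)
    (hDb : Bornology.IsBounded D) (hDV : D ⊆ V)
    (hDa : ∀ t : ℝ, 0 < t → t ≤ 1 → ∀ x ∈ D, AffineMap.homothety a t x ∈ D)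
    (hZ : volume (D ∩ {x | v x = 0}) = 0) :
    ¬ MemW1p (n : ℝ≥0∞) (V \ {x | v x = 0}) fun x => Real.log |v x| := by
  intro h
  have hp : (1 : ℝ≥0∞) ≤ n := by exact_mod_cast hn
  obtain ⟨g, hg, hT⟩ := h.exists_truncation hp hV hv
  obtain ⟨ρ, hρ0, hρ⟩ : ∃ ρ, 0 < ρ ∧ D ⊆ closedBall a ρ := by
    obtain ⟨ρ, hρ⟩ := hDb.subset_closedBall a
    exact ⟨max ρ 1, by positivity, hρ.trans (closedBall_subset_closedBall (le_max_left _ _))⟩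
  set r : ℕ → ℝ := fun j => 2⁻¹ ^ j
  have hr0 (j) : 0 < r j := by positivity
  have hr1 (j) : r j ≤ 1 := pow_le_one₀ (by norm_num) (by norm_num)
  set S : ℕ → Set (EuclideanSpace ℝ (Fin n)) := fun j => AffineMap.homothety a (r j) '' D
  have hSo (j) : IsOpen (S j) := AffineMap.homothety_isOpenMap a (r j) (hr0 j).ne' D hD
  have hSc (j) : Convex ℝ (S j) := hDc.affine_image _
  have hSn (j) : (S j).Nonempty := hDn.image _
  have hSD (j) : S j ⊆ D := by
    rintro _ ⟨x, hx, rfl⟩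
    exact hDa _ (hr0 j) (hr1 j) x hx
  have hSs (j) : S (j + 1) ⊆ S j := by
    rintro _ ⟨x, hx, rfl⟩
    refine ⟨_, hDa 2⁻¹ (by norm_num) (by norm_num) x hx, ?_⟩
    rw [← AffineMap.homothety_mul_apply]
    simp only [r, pow_succ]
  have hSb (j) : S j ⊆ closedBall a (r j * ρ) := by
    rintro _ ⟨x, hx, rfl⟩
    rw [mem_closedBall, dist_homothety_center, Real.norm_of_nonneg (hr0 j).le, dist_comm]
    exact mul_le_mul_of_nonneg_left (hρ hx) (hr0 j).le
  have hM : 0 < volume.real D :=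
    ENNReal.toReal_pos (hD.measure_pos volume hDn).ne' hDb.measure_lt_top.ne
  have hSf (j) : volume (S j) ≠ ⊤ := (hDb.subset (hSD j)).measure_lt_top.ne
  have hSμ (j) : volume.real (S j) = r j ^ n * volume.real D := by
    simp only [S, Measure.real, Measure.addHaar_image_homothety, finrank_euclideanSpace_fin,
      ENNReal.toReal_mul, ENNReal.toReal_ofReal (abs_nonneg _)]
    rw [abs_of_pos (pow_pos (hr0 j) n)]
  have hgi (j) : IntegrableOn g (S j) := by
    have : IsFiniteMeasure (volume.restrict (S j)) := ⟨by simpa using (hSf j).lt_top⟩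
    exact (hg.restrict (S j)).integrable hp
  have hlog2 : 0 < Real.log 2 := Real.log_pos (by norm_num)
  -- consecutive means of the truncations differ by at most `log 2 / 2` from some scale on
  obtain ⟨j₀, hj₀⟩ : ∃ j₀, ∀ j ≥ j₀, ∀ (K' : ℝ≥0)
      (W : EuclideanSpace ℝ (Fin n) → ℝ), LipschitzWith K' W →
      (∀ᵐ x, x ∈ V → ‖fderiv ℝ W x‖ ≤ ‖g x‖) →
      |(⨍ x in S (j + 1), W x) - ⨍ x in S j, W x| ≤ Real.log 2 / 2 := by
    -- Chosen so that the mean comparison yields exactly `log 2 / 2`; all powers of `r (j + 1)`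
    -- cancel because the exponent is `n`.
    set ε : ℝ := Real.log 2 / 2 * volume.real D / (ρ * 2 ^ (2 * n + 2))
    have hε : 0 < ε := by positivity
    have hev := MemLp.eventually_setIntegral_norm_le volume (g := g) (D := S)
      (by simpa using hn) (by simpa using hg) hM (fun j => by rw [finrank_euclideanSpace_fin, hSμ]) hSf hε
    rw [finrank_euclideanSpace_fin, eventually_atTop] at hev
    obtain ⟨j₀, hj₀⟩ := hev
    refine ⟨j₀, fun j hj K' W hW hWg => ?_⟩
    refine (hW.abs_setAverage_sub_setAverage_le volume (hSc j) (hSo j) (hSo (j + 1))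
      (hSn (j + 1)) (hSs j) (hSb j) (hgi j)
      (hWg.mono fun x hx hxS => hx (hDV (hSD j hxS)))).trans ?_
    rw [finrank_euclideanSpace_fin, hSμ]
    calc _ ≤ (r (j + 1) ^ n * volume.real D)⁻¹ * (2 * (r j * ρ) * (2 ^ (n + 1) *
          (ε * r j ^ (n - 1)))) := by
          have h1 := hr0 j
          have h2 := hr0 (j + 1)
          gcongr
          exact hj₀ j hj
      _ = _ := by
          have h1 := (hr0 (j + 1)).ne'
          have h2 : r j = 2 * r (j + 1) := by simp only [r, pow_succ]; ring
          obtain ⟨k, rfl⟩ : ∃ k, n = k + 1 := ⟨_, (Nat.sub_add_cancel hn).symm⟩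
          rw [h2, Nat.add_sub_cancel]
          simp only [ε]
          field_simp
          ring_nf
  -- the truncations have a common lower bound for their means at scale `j₀`
  have hfi : IntegrableOn (fun x => Real.log |v x|) (S j₀) := by
    have : IsFiniteMeasure (volume.restrict (S j₀)) := ⟨by simpa using (hSf j₀).lt_top⟩
    have hae : (S j₀ \ {x | v x = 0} : Set _) =ᵐ[volume] S j₀ := by
      refine sdiff_ae_eq_self.2 (measure_mono_null ?_ hZ)
      exact inter_subset_inter_left _ (hSD j₀)
    have h1 : MemLp (fun x => Real.log |v x|) n (volume.restrict (S j₀)) := by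
      rw [← Measure.restrict_congr_set hae]
      exact h.1.mono_measure (Measure.restrict_mono
        (sdiff_subset_sdiff_left ((hSD j₀).trans hDV)) le_rfl)
    exact h1.integrable hp
  set m := ⨍ x in S j₀, Real.log |v x|
  have hWi {K' : ℝ≥0} {W : EuclideanSpace ℝ (Fin n) → ℝ} (hW : LipschitzWith K' W) (j) :
      IntegrableOn W (S j) :=
    (hW.continuous.continuousOn.integrableOn_compact (isCompact_closedBall a _)).mono_set (hSb j)
  have hbound (k : ℕ) : m - k * (Real.log 2 / 2)
      ≤ Real.log ((K + 1) * ρ) - (j₀ + k : ℕ) * Real.log 2 := by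
    -- This level dominates `|v|` on `S (j₀ + k)`, so the truncation is the constant `log c` there.
    -- Using `K + 1` keeps `c` positive when `K = 0`. The level depends on `k`, but `j₀` and `m` do
    -- not.
    set c : ℝ := r (j₀ + k) * ((K + 1) * ρ)
    have hc : 0 < c := mul_pos (hr0 _) (by positivity)
    obtain ⟨K', W, hW, hWe, hWg⟩ := hT c hc
    have hstart : m ≤ ⨍ x in S j₀, W x := by
      simp only [m, setAverage_eq, smul_eq_mul]
      refine mul_le_mul_of_nonneg_left (integral_mono_ae hfi (hWi hW j₀) ?_) (by positivity)
      -- Zeros must be discarded: `Real.log 0 = 0` could exceed the truncation.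
      have hne : ∀ᵐ x, x ∉ D ∩ {x | v x = 0} := measure_eq_zero_iff_ae_notMem.1 hZ
      filter_upwards [ae_restrict_of_ae hne, ae_restrict_mem (hSo j₀).measurableSet] with x hx hxS
      rw [hWe x (hDV (hSD j₀ hxS))]
      exact Real.log_le_log (abs_pos.2 fun h0 => hx ⟨hSD j₀ hxS, h0⟩) (le_max_left _ _)
    have hdesc (i : ℕ) : m - i * (Real.log 2 / 2) ≤ ⨍ x in S (j₀ + i), W x := by
      induction i with
      | zero => simpa using hstart
      | succ i ih =>
        have h1 := hj₀ (j₀ + i) (Nat.le_add_right _ _) K' W hW hWg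
        have h2 := (abs_le.1 h1).1
        push_cast
        rw [← add_assoc]
        linarith
    refine (hdesc k).trans ?_
    have hlogc : Real.log ((K + 1) * ρ) - (j₀ + k : ℕ) * Real.log 2 = Real.log c := by
      rw [Real.log_mul (hr0 _).ne' (by positivity), Real.log_pow, Real.log_inv]
      ring
    rw [hlogc]
    have hSr : 0 < volume.real (S (j₀ + k)) := by
      rw [hSμ]; exact mul_pos (pow_pos (hr0 _) n) hM
    have hconst : ⨍ x in S (j₀ + k), Real.log c = Real.log c := by
      rw [setAverage_eq, setIntegral_const, smul_eq_mul, smul_eq_mul, inv_mul_cancel_left₀ hSr.ne']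
    rw [← hconst, setAverage_eq, setAverage_eq, smul_eq_mul, smul_eq_mul]
    refine mul_le_mul_of_nonneg_left (setIntegral_mono_on (hWi hW _)
      (integrableOn_const (hSf _)) (hSo _).measurableSet fun x hx => ?_) (by positivity)
    have hxV := hDV (hSD _ hx)
    rw [hWe x hxV, max_eq_right]
    calc |v x| ≤ K * dist x a := hva x hxV
      _ ≤ (K + 1) * (r (j₀ + k) * ρ) := by
          gcongr
          · linarith
          · exact hSb _ hx
      _ = c := by simp only [c]; ring
  obtain ⟨k, hk⟩ := exists_nat_gt ((Real.log ((K + 1) * ρ) - m) / (Real.log 2 / 2))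
  rw [div_lt_iff₀ (by positivity)] at hk
  have h1 := hbound k
  push_cast at h1
  have h2 : 0 ≤ (j₀ : ℝ) * Real.log 2 := by positivity
  nlinarith

/-! ### Geometry of the domain near a point. -/

/-- Local geometry at a point of an open set or at a Lipschitz boundary point: all nearby points
of `Ω` lie in one connected piece, and a truncated cone with vertex `a` fits into `Ω`. -/
theorem exists_connected_and_cone {n : ℕ} {Ω X : Set (EuclideanSpace ℝ (Fin n))} (hΩ : IsOpen Ω)
    (hX : X = Ω ∨ (HasLipschitzBoundary Ω ∧ X = closure Ω)) {a : EuclideanSpace ℝ (Fin n)}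
    (ha : a ∈ X) {ε : ℝ} (hε : 0 < ε) :
    (∃ δ > 0, ∃ b, ∀ x ∈ Ω ∩ ball a δ, ∃ T, IsPreconnected T ∧ b ∈ T ∧ x ∈ T ∧
      T ⊆ Ω ∩ ball a ε) ∧
    ∀ δ > 0, ∃ D, IsOpen D ∧ Convex ℝ D ∧ D.Nonempty ∧ D ⊆ Ω ∩ ball a δ ∧
      ∀ t : ℝ, 0 < t → t ≤ 1 → ∀ x ∈ D, AffineMap.homothety a t x ∈ D := by
  by_cases haΩ : a ∈ Ω
  · obtain ⟨η, hη, hηΩ⟩ := Metric.isOpen_iff.1 hΩ a haΩ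
    refine ⟨⟨min η ε, by positivity, a, fun x hx => ⟨ball a (min η ε),
      (convex_ball a _).isPreconnected, mem_ball_self (by positivity), hx.2, ?_⟩⟩,
      fun δ hδ => ⟨ball a (min η δ), isOpen_ball, convex_ball a _, ⟨a, mem_ball_self
        (by positivity)⟩, ?_, fun t ht ht1 x hx => ?_⟩⟩
    · exact subset_inter ((ball_subset_ball (min_le_left _ _)).trans hηΩ)
        (ball_subset_ball (min_le_right _ _))
    · exact subset_inter ((ball_subset_ball (min_le_left _ _)).trans hηΩ)
        (ball_subset_ball (min_le_right _ _))
    · rw [mem_ball, dist_homothety_center, Real.norm_of_nonneg ht.le, dist_comm]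
      exact (mul_le_of_le_one_left dist_nonneg ht1).trans_lt hx
  obtain ⟨hL, rfl⟩ : HasLipschitzBoundary Ω ∧ X = closure Ω := by
    rcases hX with rfl | h
    · exact absurd ha haΩ
    · exact h
  obtain ⟨e, K, γ, r, he, hγ, hr, hgraph⟩ := hL a ⟨ha, fun h => haΩ (interior_subset h)⟩
  set π := (Submodule.span ℝ {e})ᗮ.orthogonalProjectionOnto with hπ
  have hπ1 (y : EuclideanSpace ℝ (Fin n)) : ‖π y‖ ≤ ‖y‖ := by
    exact Submodule.norm_orthogonalProjectionOnto_apply_le _ y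
  have hπe : π e = 0 := by
    rw [hπ, Submodule.orthogonalProjectionOnto_eq_zero_iff]
    exact Submodule.le_orthogonal_orthogonal _ (Submodule.mem_span_singleton_self e)
  have hee : inner ℝ e e = 1 := by rw [real_inner_self_eq_norm_sq, he, one_pow]
  set F : EuclideanSpace ℝ (Fin n) → ℝ := fun x => inner ℝ e x - γ (π x) with hF
  have hFc : Continuous F := by
    have := hγ.continuous
    fun_prop
  have hmem {x} (hx : x ∈ ball a r) : x ∈ Ω ↔ 0 < F x := by
    rw [hgraph x hx, hF, sub_pos]
  have hFa : F a = 0 := by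
    refine le_antisymm (not_lt.1 fun h => haΩ ((hmem (mem_ball_self hr)).2 h)) ?_
    have hcl : a ∈ closure (Ω ∩ ball a r) :=
      by
      rw [inter_comm]
      exact isOpen_ball.inter_closure ⟨mem_ball_self hr, ha⟩
    refine closure_minimal (t := {x | 0 ≤ F x}) ?_ (isClosed_le continuous_const hFc) hcl
    exact fun x hx => ((hmem hx.2).1 hx.1).le
  -- Near `a` the sign of `F` decides membership in `Ω`. Since `F a = 0`, this bound makes `F`
  -- positive on the open cone `K * ‖π y‖ < inner ℝ e y` translated to `a`.
  have hFadd (x y : EuclideanSpace ℝ (Fin n)) : F x + inner ℝ e y - K * ‖π y‖ ≤ F (x + y) := by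
    have h1 := hγ.dist_le_mul (π (x + y)) (π x)
    rw [dist_eq_norm, dist_eq_norm, map_add, add_sub_cancel_left] at h1
    have h2 := (abs_le.1 h1).2
    simp only [hF, map_add, inner_add_right]
    linarith
  have hcone (δ : ℝ) (hδ : 0 < δ) : ∃ D, IsOpen D ∧ Convex ℝ D ∧ D.Nonempty ∧ D ⊆ Ω ∩ ball a δ ∧
      ∀ t : ℝ, 0 < t → t ≤ 1 → ∀ x ∈ D, AffineMap.homothety a t x ∈ D := by
    set ρ := min δ r
    have hρ : 0 < ρ := by positivity
    refine ⟨ball a ρ ∩ {x | K * ‖π (x - a)‖ - inner ℝ e (x - a) < 0},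
      isOpen_ball.inter (isOpen_lt (by fun_prop) continuous_const), ?_,
      ⟨a + (ρ / 2) • e, ?_, ?_⟩, ?_, ?_⟩
    · refine (convex_ball a ρ).inter ?_
      have hcf : ConvexOn ℝ univ
          fun y : EuclideanSpace ℝ (Fin n) => K * ‖π y‖ - inner ℝ e y := by
        refine ConvexOn.sub ?_ ?_
        · have h := (convexOn_univ_norm (E := (Submodule.span ℝ {e})ᗮ)).comp_linearMap
            π.toLinearMap
          exact ConvexOn.smul K.2 h
        · exact (innerSL ℝ e).toLinearMap.concaveOn convex_univ
      have h := (hcf.translate_left (-a)).convex_lt 0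
      simpa [← sub_eq_add_neg] using h
    · rw [mem_ball, dist_eq_norm, add_sub_cancel_left, norm_smul, he, mul_one,
        Real.norm_of_nonneg (by positivity)]
      linarith
    · simp only [mem_ofPred_eq, add_sub_cancel_left, map_smul, hπe, smul_zero, norm_zero,
        inner_smul_right, hee]
      linarith
    · rintro x ⟨hx, hx'⟩
      have hxr := ball_subset_ball (min_le_right δ r) hx
      refine ⟨(hmem hxr).2 ?_, ball_subset_ball (min_le_left δ r) hx⟩
      have h := hFadd a (x - a)
      rw [add_sub_cancel, hFa] at h
      have hx'' : K * ‖π (x - a)‖ - inner ℝ e (x - a) < 0 := hx'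
      linarith
    · rintro t ht ht1 x ⟨hx, hx'⟩
      refine ⟨?_, ?_⟩
      · rw [mem_ball, dist_homothety_center, Real.norm_of_nonneg ht.le, dist_comm]
        exact (mul_le_of_le_one_left dist_nonneg ht1).trans_lt hx
      · have h : AffineMap.homothety a t x - a = t • (x - a) := by
          simp [AffineMap.homothety_apply]
        simp only [mem_ofPred_eq, h, map_smul, norm_smul, inner_smul_right,
          Real.norm_of_nonneg ht.le]
        have hx'' : K * ‖π (x - a)‖ - inner ℝ e (x - a) < 0 := hx'
        have := mul_neg_of_pos_of_neg ht hx''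
        linarith
  refine ⟨?_, hcone⟩
  set ρ := min ε r
  have hρ : 0 < ρ := by positivity
  -- After lifting by `s = (K + 2) * δ`, the ball of radius `δ` has `F > s - (K + 1) * δ = δ > 0`,
  -- and it stays in `ball a ρ` as `s + δ < ρ`. Each nearby point of `Ω` is joined to this ball by a
  -- segment along `e`.
  set δ := ρ / (K + 4)
  have hK : (0 : ℝ) ≤ K := K.2
  have hδ : 0 < δ := by positivity
  have hδρ : (K + 4) * δ = ρ := by simp only [δ]; field_simp
  set s := (K + 2) * δ
  have hs : 0 < s := by positivity
  have hin {x : EuclideanSpace ℝ (Fin n)} (hx : x ∈ ball a δ) {t : ℝ} (ht : 0 ≤ t) (hts : t ≤ s) :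
      x + t • e ∈ ball a ρ := by
    rw [mem_ball, dist_eq_norm] at hx ⊢
    calc ‖x + t • e - a‖ = ‖(x - a) + t • e‖ := by congr 1; abel
      _ ≤ ‖x - a‖ + ‖t • e‖ := norm_add_le _ _
      _ = ‖x - a‖ + t := by rw [norm_smul, he, mul_one, Real.norm_of_nonneg ht]
      _ < ρ := by
        have : s = (K + 2) * δ := rfl
        nlinarith
  have hFt (x : EuclideanSpace ℝ (Fin n)) (t : ℝ) : F x + t ≤ F (x + t • e) := by
    have h := hFadd x (t • e)
    simp only [map_smul, hπe, smul_zero, norm_zero, inner_smul_right, hee] at h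
    linarith
  have hΩρ {x} (hx : x ∈ ball a ρ) (hFx : 0 < F x) : x ∈ Ω ∩ ball a ε :=
    ⟨(hmem (ball_subset_ball (min_le_right ε r) hx)).2 hFx, ball_subset_ball (min_le_left ε r) hx⟩
  refine ⟨δ, hδ, a + s • e, fun x hx => ?_⟩
  have hsame : x + s • e ∈ ball (a + s • e) δ := by
    rw [mem_ball, dist_add_right]
    exact hx.2
  refine ⟨ball (a + s • e) δ ∪ (fun t : ℝ => x + t • e) '' Icc 0 s, ?_,
    Or.inl (mem_ball_self hδ), Or.inr ⟨0, ⟨le_rfl, hs.le⟩, by simp⟩, ?_⟩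
  · refine IsPreconnected.union (x + s • e) hsame ⟨s, ⟨hs.le, le_rfl⟩, rfl⟩
      (convex_ball _ _).isPreconnected (isPreconnected_Icc.image _ (by fun_prop))
  · rintro y (hy | ⟨t, ht, rfl⟩)
    · have hy' : y - s • e ∈ ball a δ := by
        rw [mem_ball, dist_eq_norm] at hy ⊢
        convert hy using 2
        abel
      have h1 := hin hy' hs.le le_rfl
      rw [sub_add_cancel] at h1
      refine hΩρ h1 ?_
      have h2 := hFadd (a + s • e) (y - (a + s • e))
      rw [add_sub_cancel] at h2
      have h3 := hFt a s
      have h4 := hπ1 (y - (a + s • e))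
      have h5 := (abs_le.1 (abs_real_inner_le_norm e (y - (a + s • e)))).1
      rw [mem_ball, dist_eq_norm] at hy
      rw [he, one_mul] at h5
      have h6 : (K : ℝ) * ‖π (y - (a + s • e))‖ ≤ K * δ := by
        gcongr
        exact h4.trans hy.le
      have : s = (K + 2) * δ := rfl
      nlinarith
    · refine hΩρ (hin hx.2 ht.1 ht.2) ?_
      have h1 := hFt x t
      have h2 : 0 < F x := by
        refine (hmem (ball_subset_ball ?_ hx.2)).1 hx.1
        calc δ ≤ (K + 4) * δ := by nlinarith
          _ = ρ := hδρ
          _ ≤ r := min_le_right _ _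
      linarith [ht.1]

/-! ### Passage to the domain and conclusion. -/

theorem not_memW1p_log_abs_sub {n : ℕ} (hn : 1 ≤ n) {Ω X : Set (EuclideanSpace ℝ (Fin n))}
    (hΩ : IsOpen Ω) (hX : X = Ω ∨ (HasLipschitzBoundary Ω ∧ X = closure Ω))
    {u : EuclideanSpace ℝ (Fin n) → ℝ} {K : ℝ≥0} (hu : LipschitzOnWith K u X)
    {a : EuclideanSpace ℝ (Fin n)} (ha : a ∈ X) (hcl : a ∈ closure {x | x ∈ Ω ∧ u x ≠ u a})
    {U : Set (EuclideanSpace ℝ (Fin n))} (hU : IsOpen U) (haU : a ∈ U) :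
    ¬ MemW1p (n : ℝ≥0∞) (U ∩ (Ω \ {x | u x = u a})) (fun x => Real.log |u x - u a|) := by
  intro h
  have hp : (1 : ℝ≥0∞) ≤ n := by exact_mod_cast hn
  have hΩX : Ω ⊆ X := by
    rcases hX with rfl | ⟨-, rfl⟩
    exacts [le_rfl, subset_closure]
  set V := U ∩ Ω
  have hV : IsOpen V := hU.inter hΩ
  set v : EuclideanSpace ℝ (Fin n) → ℝ := fun x => u x - u a
  have hv : LipschitzOnWith K v V := fun x hx y hy => by
    simpa [v] using hu (hΩX hx.2) (hΩX hy.2)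
  have hva : ∀ x ∈ V, |v x| ≤ K * dist x a := fun x hx => hu.dist_le_mul x (hΩX hx.2) a ha
  have hset : U ∩ (Ω \ {x | u x = u a}) = V \ {x | v x = 0} := by
    ext x
    simp [V, v, sub_eq_zero, and_assoc]
  rw [hset] at h
  obtain ⟨ε, hε, hεU⟩ := Metric.isOpen_iff.1 hU a haU
  obtain ⟨⟨δ, hδ, b, hconn⟩, hcone⟩ := exists_connected_and_cone hΩ hX ha hε
  -- each point of `V` has a neighbourhood in which `v` vanishes identically or almost nowhere
  set P : Set (EuclideanSpace ℝ (Fin n)) := {x | ∀ᶠ y in 𝓝 x, v y = 0}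
  set Q : Set (EuclideanSpace ℝ (Fin n)) :=
    {x | ∃ B, IsOpen B ∧ x ∈ B ∧ volume (B ∩ {x | v x = 0}) = 0}
  have hP : IsOpen P := isOpen_setOfPred_eventually_nhds
  have hQ : IsOpen Q := isOpen_iff_mem_nhds.2 fun x ⟨B, hB, hx, hB0⟩ =>
    mem_of_superset (hB.mem_nhds hx) fun y hy => ⟨B, hB, hy, hB0⟩
  have hPQ : Disjoint P Q := by
    rw [disjoint_left]
    rintro x hx ⟨B, hB, hxB, hB0⟩
    have h1 : B ∩ {x | v x = 0} ∈ 𝓝 x := inter_mem (hB.mem_nhds hxB) hx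
    exact (Measure.measure_pos_of_mem_nhds volume h1).ne' hB0
  have hVPQ : V ⊆ P ∪ Q := by
    intro x hx
    obtain ⟨η, hη, hηV⟩ := Metric.isOpen_iff.1 hV x hx
    rcases h.measure_zeros_eq_zero_or hp hV hv isOpen_ball (convex_ball x η) isBounded_ball hηV
      with h0 | h0
    · exact Or.inr ⟨_, isOpen_ball, mem_ball_self hη, h0⟩
    · exact Or.inl (mem_of_superset (ball_mem_nhds x hη) h0)
  have hT {T : Set (EuclideanSpace ℝ (Fin n))} (hT : IsPreconnected T)
      (hTΩ : T ⊆ Ω ∩ ball a ε) : T ⊆ P ∨ T ⊆ Q :=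
    hT.subset_or_subset hP hQ hPQ fun x hx => hVPQ ⟨hεU (hTΩ hx).2, (hTΩ hx).1⟩
  -- A point near `a` with `u x ≠ u a` cannot lie in `P`, so its connected piece, which contains
  -- `b`, lies in `Q`. Through `b`, every other piece then lies in `Q` too.
  have hbQ : b ∈ Q := by
    obtain ⟨x, hxδ, hxΩ, hxu⟩ := mem_closure_iff_nhds.1 hcl _ (ball_mem_nhds a hδ)
    obtain ⟨T, hTc, hbT, hxT, hTΩ⟩ := hconn x ⟨hxΩ, hxδ⟩
    rcases hT hTc hTΩ with h1 | h1
    · exact absurd (sub_eq_zero.1 (h1 hxT).self_of_nhds) hxu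
    · exact h1 hbT
  have hsub : Ω ∩ ball a δ ⊆ Q := by
    intro x hx
    obtain ⟨T, hTc, hbT, hxT, hTΩ⟩ := hconn x hx
    rcases hT hTc hTΩ with h1 | h1
    · exact absurd hbQ (disjoint_left.1 hPQ (h1 hbT))
    · exact h1 hxT
  obtain ⟨D, hD, hDc, hDn, hDΩ, hDa⟩ := hcone (min δ ε) (by positivity)
  refine not_memW1p_log_abs_of_starConvex hn hV hv hva hD hDc hDn
    (isBounded_ball.subset (hDΩ.trans inter_subset_right))
    (fun x hx => ⟨hεU (ball_subset_ball (min_le_right _ _) (hDΩ hx).2), (hDΩ hx).1⟩) hDa ?_ h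
  refine measure_null_of_locally_null _ fun x hx => ?_
  obtain ⟨B, hB, hxB, hB0⟩ := hsub ⟨(hDΩ hx.1).1, ball_subset_ball (min_le_left _ _) (hDΩ hx.1).2⟩
  exact ⟨B ∩ {x | v x = 0}, inter_mem (mem_nhdsWithin_of_mem_nhds (hB.mem_nhds hxB))
    (mem_of_superset self_mem_nhdsWithin inter_subset_right), hB0⟩

theorem toReal_logAbs (t : ℝ) : (logAbs t).toReal = Real.log |t| := by
  by_cases ht : t = 0
  · simp [ht, logAbs_zero]
  · rw [logAbs_of_ne_zero ht, EReal.toReal_coe]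

/-- Since `log 0 = ⊥`, finiteness almost everywhere makes the zeros of `u - u a` null in `Ω`. Hence
`u` is nonconstant near `a`, which reduces the claim to the local statement. -/
theorem not_memW1pLocOff_logAbs_sub {n : ℕ} (hn : 1 ≤ n)
    {Ω X : Set (EuclideanSpace ℝ (Fin n))} (hΩ : IsOpen Ω)
    (hX : X = Ω ∨ (HasLipschitzBoundary Ω ∧ X = closure Ω))
    {u : EuclideanSpace ℝ (Fin n) → ℝ} {K : ℝ≥0} (hu : LipschitzOnWith K u X)
    {a : EuclideanSpace ℝ (Fin n)} (ha : a ∈ X) :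
    ¬ MemW1pLocOff (n : ℝ≥0∞) Ω X {x | u x = u a} (fun x => logAbs (u x - u a)) := by
  rintro ⟨hfin, hloc⟩
  have hcl : a ∈ closure {x | x ∈ Ω ∧ u x ≠ u a} := by
    have haΩ : a ∈ closure Ω := by
      rcases hX with rfl | ⟨-, rfl⟩
      exacts [subset_closure ha, ha]
    refine mem_closure_iff.2 fun B hB haB => ?_
    have hne : (B ∩ Ω).Nonempty := mem_closure_iff.1 haΩ B hB haB
    have hpos := (hB.inter hΩ).measure_pos volume hne
    rw [ae_restrict_iff' hΩ.measurableSet] at hfin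
    obtain ⟨x, hx, hxf⟩ := (frequently_ae_mem_iff.2 hpos.ne').and_eventually hfin |>.exists
    exact ⟨x, hx.1, hx.2, fun h => (hxf hx.2).1 (by simp [h, logAbs_zero])⟩
  obtain ⟨U, hU, haU, h⟩ := hloc a ha
  simp_rw [toReal_logAbs] at h
  exact not_memW1p_log_abs_sub hn hΩ hX hu ha hcl hU haU h

theorem mainTheorem7 (n : ℕ) (hn : 1 ≤ n)
    (Ω : Set (EuclideanSpace ℝ (Fin n))) (hΩ : IsOpen Ω)
    (X : Set (EuclideanSpace ℝ (Fin n)))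
    (hX : X = Ω ∨ (HasLipschitzBoundary Ω ∧ X = closure Ω))
    (u : EuclideanSpace ℝ (Fin n) → ℝ) (hu : ∃ K : ℝ≥0, LipschitzOnWith K u X) :
    -- with `log 0 = -∞`: for every point `a`
    (∀ a ∈ X, ¬ MemW1pLocOff (n : ℝ≥0∞) Ω X {x | u x = u a} (fun x => logAbs (u x - u a))) ∧
    -- disregarding the values on the zero set: near every `a` around which `u` is not constant
    (∀ a ∈ X, a ∈ closure {x | x ∈ Ω ∧ u x ≠ u a} →
      ∀ U : Set (EuclideanSpace ℝ (Fin n)), IsOpen U → a ∈ U →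
        ¬ MemW1p (n : ℝ≥0∞) (U ∩ (Ω \ {x | u x = u a})) (fun x => Real.log |u x - u a|)) ∧
    -- in particular
    (MemW1pLocOff (n : ℝ≥0∞) Ω X {x | u x = 0} (fun x => logAbs (u x)) → ∀ x ∈ X, u x ≠ 0) := by
  obtain ⟨K, hK⟩ := hu
  refine ⟨fun a ha => not_memW1pLocOff_logAbs_sub hn hΩ hX hK ha,
    fun a ha hcl U hU haU => not_memW1p_log_abs_sub hn hΩ hX hK ha hcl hU haU,
    fun h x hx hx0 => not_memW1pLocOff_logAbs_sub hn hΩ hX hK hx ?_⟩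
  simpa only [hx0, sub_zero] using h
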